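/- Let $H_1,K_1,H_2,K_2$ be complex Hilbert spaces, each of dimension at least $2$ (possibly infinite), and let $M=B(H_1,K_1)$ and $N=B(H_2,K_2)$ be the type 1 Cartan factors of bounded linear operators, with the triple product $\{x,y,z\}=\frac12(xy^*z+zy^*x)$. A minimal tripotent of $M$ is an element $e$ with $\{e,e,e\}=e$ and $\{x\in M:\{e,e,x\}=x\}=\mathbb{C}e\neq\{0\}$ (equivalently, a rank-one partial isometry); $\mathcal{U}_{min}(M)$ is the set of all of them. Let $M_*$ be the predual of $M$, viewed inside $M^*$ as the norm-closed linear span of the functionals $x\mapsto\langle x\eta,\xi\rangle$ ($\xi\in K_1$, $\eta\in H_1$). For $e\in\mathcal{U}_{min}(M)$ let $\varphi_e$ be the unique extreme point of the closed unit ball of $M_*$ with $P_2(e)(x)=\varphi_e(x)\,e$ for all $x\in M$, where $P_2(e)(x)=\{e,\{e,x,e\},e\}=ee^*xe^*e$. The triple transition pseudo-probability from $e$ to $v$ is $TTP(e,v)=\varphi_v(e)\in\mathbb{C}$. The same notions are used for $N$. Let $\Phi:\mathcal{U}_{min}(M)\to\mathcal{U}_{min}(N)$ be a bijection with $TTP(\Phi(v),\Phi(e))=TTP(v,e)$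 for all $e,v\in\mathcal{U}_{min}(M)$. Then there is a unique triple isomorphism $T:M\to N$ (a complex-linear bijection with $T\{x,y,z\}=\{Tx,Ty,Tz\}$ for all $x,y,z\in M$) whose restriction to $\mathcal{U}_{min}(M)$ is $\Phi$. Moreover, at least one of the following holds: (a) there are surjective complex-linear isometries $u:K_1\to K_2$ and $v:H_1\to H_2$ such that $T(x)=u\,x\,v^*$ for all $x\in M$; (b) there are surjective conjugate-linear isometries $u:H_1\to K_2$ and $v:K_1\to H_2$ such that $T(x)=u\,x^*\,v^*$ for all $x\in M$. Here $v^*=v^{-1}$ in both cases. -/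

import Mathlib

namespace TypeOneCartan

open ContinuousLinearMap InnerProductSpace

noncomputable section

/-- The triple product `{x, y, z} = (x y* z + z y* x) / 2` of the type 1 Cartan factor `B(H, K)`. -/
def tripleProduct {H K : Type*} [NormedAddCommGroup H] [InnerProductSpace ℂ H] [CompleteSpace H]
    [NormedAddCommGroup K] [InnerProductSpace ℂ K] [CompleteSpace K]
    (x y z : H →L[ℂ] K) : H →L[ℂ] K :=
  (1 / 2 : ℂ) • (x ∘L (adjoint y ∘L z) + z ∘L (adjoint y ∘L x))

/-- The Peirce-2 subspace of `e`: the eigenspace of `L(e, e) : x ↦ {e, e, x}` for the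
eigenvalue `1`. -/
def peirceTwo {H K : Type*} [NormedAddCommGroup H] [InnerProductSpace ℂ H] [CompleteSpace H]
    [NormedAddCommGroup K] [InnerProductSpace ℂ K] [CompleteSpace K]
    (e : H →L[ℂ] K) : Set (H →L[ℂ] K) :=
  {x | tripleProduct e e x = x}

/-- The Peirce-2 projection of a tripotent `e`, that is `P₂(e) = Q(e)²` with
`Q(e) x = {e, x, e}`; here it is the map `x ↦ e e* x e* e`. -/
def peirceTwoProj {H K : Type*} [NormedAddCommGroup H] [InnerProductSpace ℂ H] [CompleteSpace H]
    [NormedAddCommGroup K] [InnerProductSpace ℂ K] [CompleteSpace K]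
    (e x : H →L[ℂ] K) : H →L[ℂ] K :=
  tripleProduct e (tripleProduct e x e) e

/-- The set of minimal tripotents: `{e, e, e} = e` and the Peirce-2 subspace of `e` is `ℂ e ≠ 0`. -/
def minTripotents (H K : Type*) [NormedAddCommGroup H] [InnerProductSpace ℂ H] [CompleteSpace H]
    [NormedAddCommGroup K] [InnerProductSpace ℂ K] [CompleteSpace K] : Set (H →L[ℂ] K) :=
  {e | tripleProduct e e e = e ∧
    peirceTwo e = (Submodule.span ℂ {e} : Set (H →L[ℂ] K)) ∧ e ≠ 0}

/-- The functional `x ↦ ⟨x η, ξ⟩` on `B(H, K)`, for `ξ ∈ K` and `η ∈ H`.  (Mathlib's inner product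
is conjugate-linear in the first variable.) -/
def vectorFunctional {H K : Type*} [NormedAddCommGroup H] [InnerProductSpace ℂ H]
    [NormedAddCommGroup K] [InnerProductSpace ℂ K] (ξ : K) (η : H) :
    StrongDual ℂ (H →L[ℂ] K) :=
  (innerSL ℂ ξ) ∘L (ContinuousLinearMap.apply ℂ K η)

/-- The predual of `B(H, K)`, as a closed subspace of the dual of `B(H, K)`: the norm closure of
the linear span of the functionals `x ↦ ⟨x η, ξ⟩`. -/
def predual (H K : Type*) [NormedAddCommGroup H] [InnerProductSpace ℂ H]
    [NormedAddCommGroup K] [InnerProductSpace ℂ K] :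
    Submodule ℂ (StrongDual ℂ (H →L[ℂ] K)) :=
  (Submodule.span ℂ {φ | ∃ (ξ : K) (η : H), φ = vectorFunctional ξ η}).topologicalClosure

/-- The pure atoms of `B(H, K)`: the extreme points of the closed unit ball of the predual. -/
def pureAtoms (H K : Type*) [NormedAddCommGroup H] [InnerProductSpace ℂ H]
    [NormedAddCommGroup K] [InnerProductSpace ℂ K] : Set (StrongDual ℂ (H →L[ℂ] K)) :=
  Set.extremePoints ℝ {φ | φ ∈ predual H K ∧ ‖φ‖ ≤ 1}

section helpers

variable {H K : Type*} [NormedAddCommGroup H] [InnerProductSpace ℂ H]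
  [NormedAddCommGroup K] [InnerProductSpace ℂ K]

theorem vectorFunctional_apply (ξ : K) (η : H) (x : H →L[ℂ] K) :
    vectorFunctional ξ η x = inner ℂ ξ (x η) := rfl

theorem norm_vectorFunctional_le {ξ : K} {η : H} (hξ : ‖ξ‖ = 1) (hη : ‖η‖ = 1) :
    ‖vectorFunctional ξ η‖ ≤ 1 := by
  refine ContinuousLinearMap.opNorm_le_bound _ zero_le_one fun x => ?_
  rw [vectorFunctional_apply]
  calc ‖inner ℂ ξ (x η)‖ ≤ ‖ξ‖ * ‖x η‖ := norm_inner_le_norm _ _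
    _ ≤ ‖ξ‖ * (‖x‖ * ‖η‖) := by gcongr; exact x.le_opNorm η
    _ = 1 * ‖x‖ := by rw [hξ, hη]; ring

theorem norm_sq_rankOne_add_le {ξ : K} {η : H} (hξ : ‖ξ‖ = 1) (hη : ‖η‖ = 1)
    (y : H →L[ℂ] K) (hy : inner ℂ ξ (y η) = 0) :
    ‖rankOne ℂ ξ η + y‖ ^ 2 ≤ 1 + 2 * ‖y‖ ^ 2 := by
  have key : ‖rankOne ℂ ξ η + y‖ ≤ Real.sqrt (1 + 2 * ‖y‖ ^ 2) := by
    refine ContinuousLinearMap.opNorm_le_bound _ (Real.sqrt_nonneg _) fun z => ?_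
    set α : ℂ := inner ℂ η z with hα
    set w : H := z - α • η with hw
    have hz : z = α • η + w := by simp [hw]
    have hηη : inner ℂ η η = (1 : ℂ) := by
      rw [inner_self_eq_norm_sq_to_K, hη]; simp
    have hηw : inner ℂ η w = (0 : ℂ) := by
      rw [hw, inner_sub_right, inner_smul_right, hηη, ← hα]; ring
    have hnz : ‖z‖ ^ 2 = ‖α‖ ^ 2 + ‖w‖ ^ 2 := by
      have h0 : inner ℂ (α • η) w = (0 : ℂ) := by rw [inner_smul_left, hηw, mul_zero]
      have h := norm_add_sq_eq_norm_sq_add_norm_sq_of_inner_eq_zero (α • η) w h0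
      rw [← hz, norm_smul, hη] at h
      nlinarith [h]
    have h1 : (rankOne ℂ ξ η + y) z = α • ξ + y z := by
      simp [← hα]
    have h2 : inner ℂ (α • ξ) (y z) = (starRingEnd ℂ α) * inner ℂ ξ (y w) := by
      rw [inner_smul_left, hz, map_add, map_smul, inner_add_right, inner_smul_right, hy]
      ring
    have h3 : ‖inner ℂ (α • ξ) (y z)‖ ≤ ‖α‖ * (‖y‖ * ‖w‖) := by
      rw [h2, norm_mul, RCLike.norm_conj]
      gcongr
      calc ‖inner ℂ ξ (y w)‖ ≤ ‖ξ‖ * ‖y w‖ := norm_inner_le_norm _ _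
        _ ≤ ‖ξ‖ * (‖y‖ * ‖w‖) := by gcongr; exact y.le_opNorm w
        _ = ‖y‖ * ‖w‖ := by rw [hξ, one_mul]
    have h4 : RCLike.re (inner ℂ (α • ξ) (y z)) ≤ ‖α‖ * (‖y‖ * ‖w‖) :=
      (RCLike.re_le_norm _).trans h3
    have h5 : ‖y z‖ ^ 2 ≤ ‖y‖ ^ 2 * ‖z‖ ^ 2 := by
      rw [← mul_pow]; gcongr; exact y.le_opNorm z
    have h6 : ‖(rankOne ℂ ξ η + y) z‖ ^ 2 ≤ (1 + 2 * ‖y‖ ^ 2) * ‖z‖ ^ 2 := by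
      rw [h1, norm_add_sq (𝕜 := ℂ), norm_smul, hξ]
      nlinarith [sq_nonneg (‖α‖ * ‖y‖ - ‖w‖), sq_nonneg (‖y‖ * ‖w‖), sq_nonneg ‖w‖,
        sq_nonneg ‖α‖]
    rw [← Real.sqrt_sq (norm_nonneg z), ← Real.sqrt_mul (by positivity)]
    exact Real.le_sqrt_of_sq_le h6
  calc ‖rankOne ℂ ξ η + y‖ ^ 2 ≤ Real.sqrt (1 + 2 * ‖y‖ ^ 2) ^ 2 := by gcongr
    _ = _ := Real.sq_sqrt (by positivity)

/-- A contractive functional with the value `1` at `ξ ⊗ η` is the functional `x ↦ ⟨x η, ξ⟩`. -/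
theorem eq_vectorFunctional {ξ : K} {η : H} (hξ : ‖ξ‖ = 1) (hη : ‖η‖ = 1)
    (ψ : StrongDual ℂ (H →L[ℂ] K)) (hψ : ‖ψ‖ ≤ 1) (h1 : ψ (rankOne ℂ ξ η) = 1) :
    ψ = vectorFunctional ξ η := by
  have key : ∀ y : H →L[ℂ] K, inner ℂ ξ (y η) = (0 : ℂ) → ψ y = 0 := by
    intro y hy
    by_contra hne
    set r : ℝ := ‖ψ y‖ ^ 2 with hr
    have hrpos : 0 < r := by positivity
    set s : ℝ := (1 + ‖y‖ ^ 2)⁻¹ with hs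
    have hspos : 0 < s := by positivity
    have hsy : s * (1 + ‖y‖ ^ 2) = 1 := inv_mul_cancel₀ (by positivity)
    set t : ℂ := (s : ℂ) * starRingEnd ℂ (ψ y) with ht
    have htn : ‖t‖ ^ 2 = s ^ 2 * r := by
      rw [ht, norm_mul, RCLike.norm_conj, Complex.norm_real, Real.norm_of_nonneg hspos.le, mul_pow]
    have hb := norm_sq_rankOne_add_le hξ hη (t • y) (by
      simp [hy])
    rw [norm_smul, mul_pow, htn] at hb
    have hv : ψ (rankOne ℂ ξ η + t • y) = ((1 + s * r : ℝ) : ℂ) := by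
      rw [map_add, map_smul, h1, smul_eq_mul, ht, mul_assoc, RCLike.conj_mul, hr]
      push_cast
      rfl
    have hle : (1 + s * r) ≤ ‖rankOne ℂ ξ η + t • y‖ := by
      have h := ψ.le_of_opNorm_le hψ (rankOne ℂ ξ η + t • y)
      rw [hv, Complex.norm_real, one_mul, Real.norm_of_nonneg (by positivity)] at h
      exact h
    have hsq : (1 + s * r) ^ 2 ≤ 1 + 2 * (s ^ 2 * r * ‖y‖ ^ 2) :=
      (pow_le_pow_left₀ (by positivity) hle 2).trans hb
    have h7 : s * ‖y‖ ^ 2 < 1 := by nlinarith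
    have h8 : s * r * (s * ‖y‖ ^ 2) ≤ s * r * 1 := by gcongr
    nlinarith [mul_pos hspos hrpos, sq_pos_of_pos (mul_pos hspos hrpos)]
  ext x
  have h := key (x - (inner ℂ ξ (x η) : ℂ) • rankOne ℂ ξ η) (by
    simp [hη, hξ])
  rw [map_sub, map_smul, h1, sub_eq_zero] at h
  rw [h, vectorFunctional_apply]
  simp

theorem vectorFunctional_mem_pureAtoms {ξ : K} {η : H} (hξ : ‖ξ‖ = 1) (hη : ‖η‖ = 1) :
    vectorFunctional ξ η ∈ pureAtoms H K := by
  refine mem_extremePoints_iff_left.2 ⟨⟨?_, norm_vectorFunctional_le hξ hη⟩, ?_⟩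
  · exact Submodule.le_topologicalClosure _ (Submodule.subset_span ⟨ξ, η, rfl⟩)
  rintro ψ₁ ⟨-, h₁⟩ ψ₂ ⟨-, h₂⟩ ⟨a, b, ha, hb, hab, h⟩
  have hn : ‖rankOne ℂ ξ η‖ = 1 := by rw [norm_rankOne, hξ, hη, one_mul]
  have hle : ∀ ψ : StrongDual ℂ (H →L[ℂ] K), ‖ψ‖ ≤ 1 → ‖ψ (rankOne ℂ ξ η)‖ ≤ 1 := by
    intro ψ hψ
    have := ψ.le_of_opNorm_le hψ (rankOne ℂ ξ η)
    rwa [hn, one_mul] at this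
  have he : (a : ℂ) * ψ₁ (rankOne ℂ ξ η) + (b : ℂ) * ψ₂ (rankOne ℂ ξ η) = 1 := by
    have := congrArg (fun ψ : StrongDual ℂ (H →L[ℂ] K) => ψ (rankOne ℂ ξ η)) h
    simpa [vectorFunctional_apply, hη, hξ] using this
  have hre := congrArg Complex.re he
  simp only [Complex.add_re, Complex.re_ofReal_mul, Complex.one_re] at hre
  have r₁ := (Complex.re_le_norm _).trans (hle ψ₁ h₁)
  have r₂ := (Complex.re_le_norm _).trans (hle ψ₂ h₂)
  have hr : (ψ₁ (rankOne ℂ ξ η)).re = 1 := by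
    refine le_antisymm r₁ ?_
    by_contra hlt
    push Not at hlt
    nlinarith [mul_lt_mul_of_pos_left hlt ha, mul_le_mul_of_nonneg_left r₂ hb.le]
  refine eq_vectorFunctional hξ hη ψ₁ h₁ ?_
  have hq := hle ψ₁ h₁
  have hsq := Complex.sq_norm (ψ₁ (rankOne ℂ ξ η))
  rw [Complex.normSq_apply, hr] at hsq
  have him : (ψ₁ (rankOne ℂ ξ η)).im = 0 := by
    have : ‖ψ₁ (rankOne ℂ ξ η)‖ ^ 2 ≤ 1 := by
      simpa using pow_le_pow_left₀ (norm_nonneg _) hq 2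
    nlinarith [sq_nonneg (ψ₁ (rankOne ℂ ξ η)).im]
  exact Complex.ext (by simpa using hr) (by simpa using him)

variable [CompleteSpace H] [CompleteSpace K]

/-- A minimal tripotent is an operator `ξ ⊗ η` with unit vectors `ξ` and `η`. -/
theorem exists_rankOne_of_mem_minTripotents {e : H →L[ℂ] K} (he : e ∈ minTripotents H K) :
    ∃ (ξ : K) (η : H), ‖ξ‖ = 1 ∧ ‖η‖ = 1 ∧ e = rankOne ℂ ξ η := by
  obtain ⟨h1, h2, h3⟩ := he
  have hee : ∀ z, e (adjoint e (e z)) = e z := by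
    intro z
    have := congrArg (fun f : H →L[ℂ] K => f z) h1
    simp only [tripleProduct, ← two_smul ℂ, smul_smul] at this
    norm_num at this
    exact this
  obtain ⟨z, hz⟩ : ∃ z, e z ≠ 0 := by
    by_contra h
    push Not at h
    exact h3 (ContinuousLinearMap.ext (by simpa using h))
  set η₀ := adjoint e (e z) with hη₀
  have hη₀0 : η₀ ≠ 0 := by
    intro h
    apply hz
    rw [← hee z, ← hη₀, h, map_zero]
  set η : H := ((‖η₀‖ : ℂ)⁻¹) • η₀ with hη
  have hηn : ‖η‖ = 1 := by
    rw [hη, norm_smul, norm_inv, Complex.norm_real, norm_norm, inv_mul_cancel₀]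
    simpa using hη₀0
  have hq : adjoint e (e η) = η := by
    rw [hη, map_smul, map_smul, hη₀, hee]
  have hξn : ‖e η‖ = 1 := by
    have h : inner ℂ (e η) (e η) = (1 : ℂ) := by
      rw [← ContinuousLinearMap.adjoint_inner_right, hq, inner_self_eq_norm_sq_to_K, hηn]; simp
    rw [inner_self_eq_norm_sq_to_K] at h
    have h' : ‖e η‖ ^ 2 = 1 := Complex.ofReal_injective (by simpa using h)
    exact (pow_eq_one_iff_of_nonneg (norm_nonneg _) two_ne_zero).1 h'
  have hηη : inner ℂ η η = (1 : ℂ) := by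
    rw [inner_self_eq_norm_sq_to_K, hηn]; simp
  have hw : rankOne ℂ (e η) η ∈ peirceTwo e := by
    show tripleProduct e e (rankOne ℂ (e η) η) = rankOne ℂ (e η) η
    ext x
    have : inner ℂ η (adjoint e (e x)) = inner ℂ η x := by
      rw [ContinuousLinearMap.adjoint_inner_right, ← ContinuousLinearMap.adjoint_inner_left, hq]
    simp only [tripleProduct, smul_apply, add_apply,
      ContinuousLinearMap.comp_apply, rankOne_apply, map_smul, hee, this, ← two_smul ℂ, smul_smul]
    ring_nf
  rw [h2] at hw
  obtain ⟨c, hc⟩ := Submodule.mem_span_singleton.1 hw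
  have hcη := congrArg (fun f : H →L[ℂ] K => f η) hc
  simp only [smul_apply, rankOne_apply, hηη, one_smul] at hcη
  have hc1 : c = 1 := by
    have h0 : e η ≠ 0 := by intro h; rw [h, norm_zero] at hξn; exact zero_ne_one hξn
    have : (c - 1) • e η = 0 := by rw [sub_smul, hcη, one_smul, sub_self]
    exact sub_eq_zero.1 ((smul_eq_zero.1 this).resolve_right h0)
  refine ⟨e η, η, hξn, hηn, ?_⟩
  rw [← hc, hc1, one_smul]

theorem peirceTwoProj_rankOne {ξ : K} {η : H} (hξ : ‖ξ‖ = 1) (hη : ‖η‖ = 1) (x : H →L[ℂ] K) :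
    peirceTwoProj (rankOne ℂ ξ η) x = vectorFunctional ξ η x • rankOne ℂ ξ η := by
  have hηη : inner ℂ η η = (1 : ℂ) := by
    rw [inner_self_eq_norm_sq_to_K, hη]; simp
  have hξξ : inner ℂ ξ ξ = (1 : ℂ) := by
    rw [inner_self_eq_norm_sq_to_K, hξ]; simp
  have hQ : ∀ y : H →L[ℂ] K, tripleProduct (rankOne ℂ ξ η) y (rankOne ℂ ξ η) =
      (inner ℂ (y η) ξ : ℂ) • rankOne ℂ ξ η := by
    intro y
    ext z
    simp only [tripleProduct, smul_apply, add_apply,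
      ContinuousLinearMap.comp_apply, rankOne_apply, map_smul,
      ContinuousLinearMap.adjoint_inner_right, ← two_smul ℂ, smul_smul]
    ring_nf
  rw [peirceTwoProj, hQ, hQ, vectorFunctional_apply]
  simp only [smul_apply, rankOne_apply, hηη, one_smul, inner_smul_left, hξξ,
    mul_one, inner_conj_symm]

/-- For a minimal tripotent `e` there is a unique pure atom `φ` with `P₂(e)(x) = φ(x) e` for
all `x`. -/
theorem existsUnique_pureAtom {e : H →L[ℂ] K} (he : e ∈ minTripotents H K) :
    ∃! φ : StrongDual ℂ (H →L[ℂ] K), φ ∈ pureAtoms H K ∧ ∀ x, peirceTwoProj e x = φ x • e := by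
  obtain ⟨ξ, η, hξ, hη, rfl⟩ := exists_rankOne_of_mem_minTripotents he
  refine ⟨vectorFunctional ξ η, ⟨vectorFunctional_mem_pureAtoms hξ hη,
    peirceTwoProj_rankOne hξ hη⟩, ?_⟩
  rintro ψ ⟨-, hψ⟩
  ext x
  have h := (hψ x).symm.trans (peirceTwoProj_rankOne hξ hη x)
  exact smul_left_injective ℂ he.2.2 h

end helpers

/-- The pure atom `φ_e` of a minimal tripotent `e`: the unique pure atom with
`P₂(e)(x) = φ_e(x) e` for all `x`. -/
def pureAtom {H K : Type*} [NormedAddCommGroup H] [InnerProductSpace ℂ H] [CompleteSpace H]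
    [NormedAddCommGroup K] [InnerProductSpace ℂ K] [CompleteSpace K]
    (e : minTripotents H K) : StrongDual ℂ (H →L[ℂ] K) :=
  Classical.choose (existsUnique_pureAtom e.2).exists

/-- The triple transition pseudo-probability from `e` to `v`: `TTP(e, v) = φ_v(e)`. -/
def TTP {H K : Type*} [NormedAddCommGroup H] [InnerProductSpace ℂ H] [CompleteSpace H]
    [NormedAddCommGroup K] [InnerProductSpace ℂ K] [CompleteSpace K]
    (e v : minTripotents H K) : ℂ :=
  pureAtom v (e : H →L[ℂ] K)

/-- A (complex-)linear bijection is a triple isomorphism if it preserves triple products. -/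
def IsTripleIso {H₁ K₁ H₂ K₂ : Type*}
    [NormedAddCommGroup H₁] [InnerProductSpace ℂ H₁] [CompleteSpace H₁]
    [NormedAddCommGroup K₁] [InnerProductSpace ℂ K₁] [CompleteSpace K₁]
    [NormedAddCommGroup H₂] [InnerProductSpace ℂ H₂] [CompleteSpace H₂]
    [NormedAddCommGroup K₂] [InnerProductSpace ℂ K₂] [CompleteSpace K₂]
    (T : (H₁ →L[ℂ] K₁) ≃ₗ[ℂ] (H₂ →L[ℂ] K₂)) : Prop :=
  ∀ x y z, T (tripleProduct x y z) = tripleProduct (T x) (T y) (T z)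

end

end TypeOneCartan

open TypeOneCartan

/-! Write ξ ⊗ η for `rankOne ℂ ξ η`. If v = ξ ⊗ η with unit vectors, then TTP(e, v) = ⟨ξ, e η⟩, so
the hypothesis says that Φ preserves matrix coefficients. Extend Φ to F(ξ, η) = ‖ξ‖‖η‖ Φ(ξ/‖ξ‖ ⊗
η/‖η‖). By surjectivity every unit pair (a, b) comes from a unit pair (α, β), and then ⟨a, F(ξ, η)
b⟩ = ⟨α, (ξ ⊗ η) β⟩ (`inner_tensorExtension`). Matrix coefficients determine an operator, so linear
relations between elementary tensors pass to F and back: F is linear in ξ, conjugate-linear in η,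
and reflects sums of rank at most one (`isRankOneMap_tensorExtension`).

The rest is a rank-one preserver argument. Each slice of F is a vector space of operators of rank at
most one, so its members share a range or a support (`common_factor`). Two slices through the same
nonzero pair cannot share the same one (`not_common_range`, `not_common_support`). Hence F(x, y) = u
x ⊗ v y or F(x, y) = u y ⊗ v x with isometries u, v, which define T on all operators by T x = u x
v⁻¹ or T x = u x* v⁻¹.

Uniqueness needs no continuity: {e, x, e} is a multiple of e whose coefficient is a matrix
coefficient of x. -/

namespace TypeOneCartan

open ContinuousLinearMap InnerProductSpace

/-! ### Elementary tensors and matrix coefficients -/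

section RankOneLemmas

variable {H K : Type*} [NormedAddCommGroup H] [InnerProductSpace ℂ H]
  [NormedAddCommGroup K] [InnerProductSpace ℂ K]

theorem inner_self_eq_one_of_norm {x : H} (hx : ‖x‖ = 1) : inner ℂ x x = (1 : ℂ) := by
  rw [inner_self_eq_norm_sq_to_K, hx]; simp

theorem rankOne_eq_zero {a : K} {b : H} : rankOne ℂ a b = 0 ↔ a = 0 ∨ b = 0 := by
  rw [← norm_eq_zero, norm_rankOne, mul_eq_zero, norm_eq_zero, norm_eq_zero]

theorem exists_normalize {x : H} (hx : x ≠ 0) : ∃ y : H, ‖y‖ = 1 ∧ x = (‖x‖ : ℂ) • y := by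
  have h : (‖x‖ : ℂ) ≠ 0 := by simpa using hx
  refine ⟨(‖x‖ : ℂ)⁻¹ • x, ?_, ?_⟩
  · rw [norm_smul, norm_inv, Complex.norm_real, norm_norm, inv_mul_cancel₀ (by simpa using hx)]
  · rw [smul_smul, mul_inv_cancel₀ h, one_smul]

/-- If the sum of two operators of rank at most one has rank at most one, then their ranges or
their initial vectors are parallel. -/
theorem parallel_of_rankOne_add_rankOne {a c e : K} {b d f : H} (ha : a ≠ 0) (hb : b ≠ 0)
    (h : rankOne ℂ a b + rankOne ℂ c d = rankOne ℂ e f) :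
    (∃ t : ℂ, c = t • a) ∨ ∃ t : ℂ, d = t • b := by
  by_contra hcon
  push Not at hcon
  obtain ⟨hc, hd⟩ := hcon
  have hbb : inner ℂ b b ≠ (0 : ℂ) := inner_self_ne_zero.2 hb
  set s : ℂ := inner ℂ b d / inner ℂ b b with hs
  -- The component z of d orthogonal to b kills the first tensor, so evaluation at z makes e a
  -- multiple of c; evaluation at b then makes a a multiple of c.
  set z : H := d - s • b with hz
  have hz0 : z ≠ 0 := fun h0 => hd s (sub_eq_zero.1 h0)
  have hbz : inner ℂ b z = (0 : ℂ) := by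
    rw [hz, inner_sub_right, inner_smul_right, hs, div_mul_cancel₀ _ hbb, sub_self]
  have hdz : inner ℂ d z ≠ (0 : ℂ) := by
    have : d = z + s • b := by rw [hz]; abel
    rw [this, inner_add_left, inner_smul_left, hbz, mul_zero, add_zero]
    exact inner_self_ne_zero.2 hz0
  have h1 : (inner ℂ d z : ℂ) • c = (inner ℂ f z : ℂ) • e := by
    simpa [hbz] using congrArg (fun T : H →L[ℂ] K => T z) h
  have h2 : (inner ℂ b b : ℂ) • a + (inner ℂ d b : ℂ) • c = (inner ℂ f b : ℂ) • e := by
    simpa using congrArg (fun T : H →L[ℂ] K => T b) h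
  by_cases hfz : inner ℂ f z = (0 : ℂ)
  · rw [hfz, zero_smul, smul_eq_zero] at h1
    exact hc 0 (by rw [zero_smul]; exact h1.resolve_left hdz)
  have he : e = ((inner ℂ f z : ℂ)⁻¹ * inner ℂ d z) • c := by
    rw [mul_smul, h1, smul_smul, inv_mul_cancel₀ hfz, one_smul]
  obtain ⟨r, hr⟩ : ∃ r : ℂ, a = r • c := by
    refine ⟨(inner ℂ b b : ℂ)⁻¹ * ((inner ℂ f b : ℂ) * ((inner ℂ f z : ℂ)⁻¹ * inner ℂ d z)
      - inner ℂ d b), ?_⟩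
    rw [mul_smul, sub_smul, mul_smul, ← he, ← h2, add_sub_cancel_right, smul_smul,
      inv_mul_cancel₀ hbb, one_smul]
  have hr0 : r ≠ 0 := by rintro rfl; exact ha (by rw [hr, zero_smul])
  exact hc r⁻¹ (by rw [hr, smul_smul, inv_mul_cancel₀ hr0, one_smul])

theorem exists_not_parallel (h : 2 ≤ Module.rank ℂ H) (x : H) : ∃ y : H, ∀ t : ℂ, y ≠ t • x := by
  by_contra hcon
  push Not at hcon
  have : Module.rank ℂ H ≤ 1 := rank_le_one_iff.2 ⟨x, fun y => by
    obtain ⟨t, ht⟩ := hcon y; exact ⟨t, ht.symm⟩⟩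
  exact absurd (h.trans this) (by norm_num)

theorem eq_of_inner_apply_eq {S T : H →L[ℂ] K}
    (h : ∀ (a : K) (b : H), ‖a‖ = 1 → ‖b‖ = 1 → inner ℂ a (S b) = (inner ℂ a (T b) : ℂ)) :
    S = T := by
  ext b
  refine ext_inner_left ℂ fun a => ?_
  rcases eq_or_ne a 0 with rfl | ha
  · simp
  rcases eq_or_ne b 0 with rfl | hb
  · simp
  obtain ⟨a', ha', ea⟩ := exists_normalize ha
  obtain ⟨b', hb', eb⟩ := exists_normalize hb
  rw [ea, eb, map_smul, map_smul, inner_smul_left, inner_smul_left, inner_smul_right,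
    inner_smul_right, h a' b' ha' hb']

end RankOneLemmas

/-! ### Factorization of rank-one maps -/

section RankOneMaps

variable {A B H K : Type*} [NormedAddCommGroup A] [InnerProductSpace ℂ A]
  [NormedAddCommGroup B] [InnerProductSpace ℂ B]
  [NormedAddCommGroup H] [InnerProductSpace ℂ H] [NormedAddCommGroup K] [InnerProductSpace ℂ K]

/-- A norm-multiplicative bi-semilinear map onto the operators of rank at most one, which reflects
the property that a sum of two elements has rank at most one. -/
structure IsRankOneMap (σ τ : ℂ →+* ℂ) (F : A → B → (H →L[ℂ] K)) : Prop where
  add_left : ∀ x x' y, F (x + x') y = F x y + F x' y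
  add_right : ∀ x y y', F x (y + y') = F x y + F x y'
  smul_left : ∀ (c : ℂ) x y, F (c • x) y = σ c • F x y
  smul_right : ∀ (c : ℂ) x y, F x (c • y) = τ c • F x y
  norm_map : ∀ x y, ‖F x y‖ = ‖x‖ * ‖y‖
  rank : ∀ x y, ∃ a b, F x y = rankOne ℂ a b
  surj : ∀ a b, ∃ x y, F x y = rankOne ℂ a b
  parallel : ∀ x₁ y₁ x₂ y₂ x y, x₁ ≠ 0 → y₁ ≠ 0 → F x₁ y₁ + F x₂ y₂ = F x y →
    (∃ t : ℂ, x₂ = t • x₁) ∨ ∃ t : ℂ, y₂ = t • y₁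

namespace IsRankOneMap

variable {σ τ : ℂ →+* ℂ} {F : A → B → (H →L[ℂ] K)}

theorem flip (hF : IsRankOneMap σ τ F) : IsRankOneMap τ σ (fun y x => F x y) where
  add_left x x' y := hF.add_right y x x'
  add_right x y y' := hF.add_left y y' x
  smul_left c x y := hF.smul_right c y x
  smul_right c x y := hF.smul_left c y x
  norm_map x y := (hF.norm_map y x).trans (mul_comm _ _)
  rank x y := hF.rank y x
  surj a b := by obtain ⟨x, y, h⟩ := hF.surj a b; exact ⟨y, x, h⟩
  parallel x₁ y₁ x₂ y₂ x y hx hy h := (hF.parallel y₁ x₁ y₂ x₂ y x hy hx h).symm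

theorem eq_zero_iff (hF : IsRankOneMap σ τ F) {x : A} {y : B} : F x y = 0 ↔ x = 0 ∨ y = 0 := by
  rw [← norm_eq_zero, hF.norm_map, mul_eq_zero, norm_eq_zero, norm_eq_zero]

/-- Adding F x₀ y₀ = a ⊗ b to F x y₀ gives rank at most one, so each F x y₀ has the form a ⊗ d or c
⊗ b. These two forms are subspaces, and a vector space is not the union of two proper subspaces. -/
theorem common_factor (hF : IsRankOneMap σ τ F) {x₀ : A} {y₀ : B} (hx₀ : x₀ ≠ 0) (hy₀ : y₀ ≠ 0)
    {a : K} {b : H} (h₀ : F x₀ y₀ = rankOne ℂ a b) :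
    (∀ x, ∃ d, F x y₀ = rankOne ℂ a d) ∨ ∀ x, ∃ c, F x y₀ = rankOne ℂ c b := by
  have hab : ¬ (a = 0 ∨ b = 0) := by
    rw [← rankOne_eq_zero, ← h₀, hF.eq_zero_iff]
    exact fun h => h.elim hx₀ hy₀
  push Not at hab
  have key : ∀ x, (∃ d, F x y₀ = rankOne ℂ a d) ∨ ∃ c, F x y₀ = rankOne ℂ c b := by
    intro x
    obtain ⟨c, d, hx⟩ := hF.rank x y₀
    obtain ⟨e, f, he⟩ := hF.rank (x₀ + x) y₀
    rw [hF.add_left, h₀, hx] at he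
    rcases parallel_of_rankOne_add_rankOne hab.1 hab.2 he with ⟨t, rfl⟩ | ⟨t, rfl⟩
    · exact .inl ⟨starRingEnd ℂ t • d, by rw [hx]; simp⟩
    · exact .inr ⟨starRingEnd ℂ t • c, by rw [hx]; simp⟩
  by_contra hcon
  push Not at hcon
  obtain ⟨⟨x₁, h₁⟩, x₂, h₂⟩ := hcon
  obtain ⟨c, hc⟩ := (key x₁).resolve_left fun ⟨d, hd⟩ => h₁ d hd
  obtain ⟨d, hd⟩ := (key x₂).resolve_right fun ⟨c, hc⟩ => h₂ c hc
  have hs := hF.add_left x₁ x₂ y₀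
  rcases key (x₁ + x₂) with ⟨e, he⟩ | ⟨e, he⟩
  · exact h₁ (e - d) (by rw [map_sub, ← he, ← hd, hs, add_sub_cancel_right])
  · exact h₂ (e - c) (by rw [map_sub, sub_apply, ← he, ← hc, hs, add_sub_cancel_left])

/-- Otherwise F x₀ y₁ + F x₁ y₀ has rank at most one for all x₁, y₁, hence is a value of F by
surjectivity. The field `parallel` then contradicts a choice of x₁, y₁ not parallel to x₀, y₀. -/
theorem not_common_range (hF : IsRankOneMap σ τ F) (hA : 2 ≤ Module.rank ℂ A)
    (hB : 2 ≤ Module.rank ℂ B) {x₀ : A} {y₀ : B} (hx₀ : x₀ ≠ 0) (hy₀ : y₀ ≠ 0) {a : K}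
    (h₁ : ∀ x, ∃ d, F x y₀ = rankOne ℂ a d) (h₂ : ∀ y, ∃ d, F x₀ y = rankOne ℂ a d) : False := by
  obtain ⟨x₁, hx₁⟩ := exists_not_parallel hA x₀
  obtain ⟨y₁, hy₁⟩ := exists_not_parallel hB y₀
  obtain ⟨d₁, hd₁⟩ := h₁ x₁
  obtain ⟨d₂, hd₂⟩ := h₂ y₁
  obtain ⟨x, y, h⟩ := hF.surj a (d₂ + d₁)
  have hy₁0 : y₁ ≠ 0 := by simpa using hy₁ 0
  rcases hF.parallel x₀ y₁ x₁ y₀ x y hx₀ hy₁0 (by rw [h, hd₁, hd₂, map_add]) with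
    ⟨t, ht⟩ | ⟨t, ht⟩
  · exact hx₁ t ht
  · have ht0 : t ≠ 0 := by rintro rfl; exact hy₀ (by rw [ht, zero_smul])
    exact hy₁ t⁻¹ (by rw [ht, smul_smul, inv_mul_cancel₀ ht0, one_smul])

theorem not_common_support (hF : IsRankOneMap σ τ F) (hA : 2 ≤ Module.rank ℂ A)
    (hB : 2 ≤ Module.rank ℂ B) {x₀ : A} {y₀ : B} (hx₀ : x₀ ≠ 0) (hy₀ : y₀ ≠ 0) {b : H}
    (h₁ : ∀ x, ∃ c, F x y₀ = rankOne ℂ c b) (h₂ : ∀ y, ∃ c, F x₀ y = rankOne ℂ c b) : False := by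
  obtain ⟨x₁, hx₁⟩ := exists_not_parallel hA x₀
  obtain ⟨y₁, hy₁⟩ := exists_not_parallel hB y₀
  obtain ⟨c₁, hc₁⟩ := h₁ x₁
  obtain ⟨c₂, hc₂⟩ := h₂ y₁
  obtain ⟨x, y, h⟩ := hF.surj (c₂ + c₁) b
  have hy₁0 : y₁ ≠ 0 := by simpa using hy₁ 0
  rcases hF.parallel x₀ y₁ x₁ y₀ x y hx₀ hy₁0 (by rw [h, hc₁, hc₂, map_add, add_apply]) with
    ⟨t, ht⟩ | ⟨t, ht⟩
  · exact hx₁ t ht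
  · have ht0 : t ≠ 0 := by rintro rfl; exact hy₀ (by rw [ht, zero_smul])
    exact hy₁ t⁻¹ (by rw [ht, smul_smul, inv_mul_cancel₀ ht0, one_smul])

variable [CompleteSpace H] [CompleteSpace K] [RingHomInvPair σ σ]

/-- The slices through (x₀, y₀) define u and v; excluding the wrong alternatives on all other slices
gives F x y = t (u x ⊗ v y), and additivity forces t = 1. As the tensor is conjugate-linear in its
second factor, `hστ` makes v semilinear for the same σ as u. -/
theorem exists_factorization (hF : IsRankOneMap σ τ F) (hστ : ∀ c, τ c = starRingEnd ℂ (σ c))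
    (hA : 2 ≤ Module.rank ℂ A) (hB : 2 ≤ Module.rank ℂ B) {x₀ : A} {y₀ : B}
    (hx₀ : ‖x₀‖ = 1) (hy₀ : ‖y₀‖ = 1) {a : K} {b : H} (ha : ‖a‖ = 1) (hb : ‖b‖ = 1)
    (h₀ : F x₀ y₀ = rankOne ℂ a b) (hleft : ∀ x, ∃ c, F x y₀ = rankOne ℂ c b) :
    ∃ (u : A ≃ₛₗᵢ[σ] K) (v : B ≃ₛₗᵢ[σ] H), ∀ x y, F x y = rankOne ℂ (u x) (v y) := by
  have hx₀' : x₀ ≠ 0 := norm_ne_zero_iff.1 (by rw [hx₀]; exact one_ne_zero)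
  have hy₀' : y₀ ≠ 0 := norm_ne_zero_iff.1 (by rw [hy₀]; exact one_ne_zero)
  have hright : ∀ y, ∃ d, F x₀ y = rankOne ℂ a d :=
    (hF.flip.common_factor hy₀' hx₀' h₀).resolve_right
      fun h => hF.not_common_support hA hB hx₀' hy₀' hleft h
  let u : A →ₛₗᵢ[σ] K :=
    { toFun := fun x => F x y₀ b
      map_add' := fun x x' => by rw [hF.add_left, add_apply]
      map_smul' := fun c x => by rw [hF.smul_left, smul_apply]
      norm_map' := fun x => by
        obtain ⟨c, hc⟩ := hleft x
        have h := hF.norm_map x y₀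
        rw [hc, norm_rankOne, hb, hy₀, mul_one, mul_one] at h
        change ‖F x y₀ b‖ = ‖x‖
        rw [hc, rankOne_apply, inner_self_eq_one_of_norm hb, one_smul, h] }
  have hu : ∀ x, F x y₀ = rankOne ℂ (u x) b := by
    intro x
    obtain ⟨c, hc⟩ := hleft x
    change _ = rankOne ℂ (F x y₀ b) b
    rw [hc, rankOne_apply, inner_self_eq_one_of_norm hb, one_smul]
  have hadj : ∀ d : H, adjoint (rankOne ℂ a d) a = d := by
    intro d
    rw [adjoint_rankOne, rankOne_apply, inner_self_eq_one_of_norm ha, one_smul]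
  let v : B →ₛₗᵢ[σ] H :=
    { toFun := fun y => adjoint (F x₀ y) a
      map_add' := fun y y' => by rw [hF.add_right, map_add, add_apply]
      map_smul' := fun c y => by
        rw [hF.smul_right, hστ, map_smulₛₗ, smul_apply, starRingEnd_self_apply]
      norm_map' := fun y => by
        obtain ⟨d, hd⟩ := hright y
        have h := hF.norm_map x₀ y
        rw [hd, norm_rankOne, ha, hx₀, one_mul, one_mul] at h
        change ‖adjoint (F x₀ y) a‖ = ‖y‖
        rw [hd, hadj, h] }
  have hv : ∀ y, F x₀ y = rankOne ℂ a (v y) := by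
    intro y
    obtain ⟨d, hd⟩ := hright y
    change _ = rankOne ℂ a (adjoint (F x₀ y) a)
    rw [hd, hadj]
  have hua : u x₀ = a := by
    change F x₀ y₀ b = a
    rw [h₀, rankOne_apply, inner_self_eq_one_of_norm hb, one_smul]
  have hu0 : ∀ x, x ≠ 0 → u x ≠ 0 := fun x hx => by
    rw [← norm_ne_zero_iff, u.norm_map]; simpa using hx
  have hv0 : ∀ y, y ≠ 0 → v y ≠ 0 := fun y hy => by
    rw [← norm_ne_zero_iff, v.norm_map]; simpa using hy
  -- The slice at y₀ has common support b, so the slice at x must have common range u x. Likewise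
  -- the slice at x₀ has common range a, so the slice at y must have common support v y.
  have hmul : ∀ x y, x ≠ 0 → y ≠ 0 → ∃ t : ℂ, F x y = t • rankOne ℂ (u x) (v y) := by
    intro x y hx hy
    obtain ⟨d, hd⟩ := (hF.flip.common_factor hy₀' hx (hu x)).resolve_right
      (fun h => hF.not_common_support hA hB hx hy₀' hleft h) y
    obtain ⟨c, hc⟩ := (hF.common_factor hx₀' hy (hv y)).resolve_left
      (fun h => hF.not_common_range hA hB hx₀' hy h hright) x
    have hvv : inner ℂ (v y) (v y) ≠ (0 : ℂ) := inner_self_ne_zero.2 (hv0 y hy)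
    refine ⟨(inner ℂ (v y) (v y))⁻¹ * inner ℂ d (v y), ?_⟩
    have h := congrArg (fun T : H →L[ℂ] K => T (v y)) (hc.symm.trans hd)
    simp only [rankOne_apply] at h
    have hc' : c = ((inner ℂ (v y) (v y))⁻¹ * inner ℂ d (v y) : ℂ) • u x := by
      rw [mul_smul, ← h, smul_smul, inv_mul_cancel₀ hvv, one_smul]
    rw [hc, hc', map_smul, smul_apply]
  have hfac : ∀ x y, F x y = rankOne ℂ (u x) (v y) := by
    intro x y
    rcases eq_or_ne y 0 with rfl | hy
    · rw [hF.eq_zero_iff.2 (.inr rfl), map_zero, map_zero]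
    by_cases hx : ∃ c : ℂ, x = c • x₀
    · obtain ⟨c, rfl⟩ := hx
      rw [hF.smul_left, hv, map_smulₛₗ, hua, map_smul, smul_apply]
    -- For x outside ℂ x₀, the scalars t at x and s at x₀ + x satisfy a + t u x = s a + s u x. Since
    -- u x and a = u x₀ are independent, t = s = 1.
    push Not at hx
    have hx0 : x ≠ 0 := by simpa using hx 0
    have hs0 : x₀ + x ≠ 0 := fun h => hx (-1) (by
      rw [neg_one_smul]; exact eq_neg_of_add_eq_zero_right h)
    obtain ⟨t, ht⟩ := hmul x y hx0 hy
    obtain ⟨s, hs⟩ := hmul (x₀ + x) y hs0 hy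
    rw [hF.add_left, ht, hv, map_add, hua] at hs
    have hvv : inner ℂ (v y) (v y) ≠ (0 : ℂ) := inner_self_ne_zero.2 (hv0 y hy)
    have h := congrArg (fun T : H →L[ℂ] K => (inner ℂ (v y) (v y))⁻¹ • T (v y)) hs
    simp only [add_apply, smul_apply, map_add, rankOne_apply] at h
    have h' : a + t • u x = s • a + s • u x := by
      rw [← smul_right_inj hvv]
      rw [← smul_right_inj (inv_ne_zero hvv)]
      refine Eq.trans ?_ (h.trans ?_)
      · module
      · module
    have hst : t = s := by
      by_contra hne
      have h2 : (t - s) • u x = (s - 1) • a := by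
        rw [sub_smul, sub_smul, one_smul, sub_eq_sub_iff_add_eq_add, ← h', add_comm]
      -- Since σ is an involution, any scalar is a value of σ and can be moved inside u.
      have h3 : u x = σ (σ ((t - s)⁻¹ * (s - 1))) • u x₀ := by
        rw [RingHomInvPair.comp_apply_eq, hua, mul_smul, ← h2, smul_smul,
          inv_mul_cancel₀ (sub_ne_zero.2 hne), one_smul]
      rw [← map_smulₛₗ] at h3
      exact hx _ (u.injective h3)
    subst hst
    have h4 : (t - 1) • a = 0 := by
      rw [sub_smul, one_smul, sub_eq_zero]; exact (add_right_cancel h').symm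
    have ht1 : t = 1 := by
      have := (smul_eq_zero.1 h4).resolve_right (by rw [← hua]; exact hu0 _ hx₀')
      exact sub_eq_zero.1 this
    rw [ht, ht1, one_smul]
  have husurj : Function.Surjective u := by
    intro c
    obtain ⟨x, y, h⟩ := hF.surj c b
    rw [hfac] at h
    have h1 := congrArg (fun T : H →L[ℂ] K => T b) h
    simp only [rankOne_apply] at h1
    rw [inner_self_eq_one_of_norm hb, one_smul] at h1
    exact ⟨σ (inner ℂ (v y) b) • x, by rw [map_smulₛₗ, RingHomInvPair.comp_apply_eq, h1]⟩
  have hvsurj : Function.Surjective v := by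
    intro d
    obtain ⟨x, y, h⟩ := hF.surj a d
    rw [hfac] at h
    have h1 := congrArg (fun T : H →L[ℂ] K => adjoint T a) h
    simp only [hadj] at h1
    rw [adjoint_rankOne, rankOne_apply] at h1
    exact ⟨σ (inner ℂ (u x) a) • y, by rw [map_smulₛₗ, RingHomInvPair.comp_apply_eq, h1]⟩
  exact ⟨LinearIsometryEquiv.ofSurjective u husurj, LinearIsometryEquiv.ofSurjective v hvsurj, hfac⟩

/-- A rank-one map preserves or exchanges the two tensor factors. -/
theorem exists_factorization_or_swap [RingHomInvPair τ τ]
    (hF : IsRankOneMap σ τ F) (hστ : ∀ c, τ c = starRingEnd ℂ (σ c))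
    (hA : 2 ≤ Module.rank ℂ A) (hB : 2 ≤ Module.rank ℂ B) :
    (∃ (u : A ≃ₛₗᵢ[σ] K) (v : B ≃ₛₗᵢ[σ] H), ∀ x y, F x y = rankOne ℂ (u x) (v y)) ∨
      ∃ (u : B ≃ₛₗᵢ[τ] K) (v : A ≃ₛₗᵢ[τ] H), ∀ x y, F x y = rankOne ℂ (u y) (v x) := by
  obtain ⟨x₁, hx₁⟩ := exists_not_parallel hA 0
  obtain ⟨y₁, hy₁⟩ := exists_not_parallel hB 0
  obtain ⟨x₀, hx₀, -⟩ := exists_normalize (x := x₁) (by simpa using hx₁ 0)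
  obtain ⟨y₀, hy₀, -⟩ := exists_normalize (x := y₁) (by simpa using hy₁ 0)
  have hx₀' : x₀ ≠ 0 := norm_ne_zero_iff.1 (by rw [hx₀]; exact one_ne_zero)
  have hy₀' : y₀ ≠ 0 := norm_ne_zero_iff.1 (by rw [hy₀]; exact one_ne_zero)
  obtain ⟨a, b, ha, hb, h₀⟩ : ∃ (a : K) (b : H), ‖a‖ = 1 ∧ ‖b‖ = 1 ∧
      F x₀ y₀ = rankOne ℂ a b := by
    obtain ⟨a, b, h⟩ := hF.rank x₀ y₀
    have hn : ‖a‖ * ‖b‖ = 1 := by rw [← norm_rankOne (𝕜 := ℂ), ← h, hF.norm_map, hx₀, hy₀, one_mul]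
    have hb : b ≠ 0 := by rintro rfl; simp at hn
    obtain ⟨b', hb', eb⟩ := exists_normalize hb
    -- Since ‖a‖‖b‖ = 1, moving the norm of b onto a makes both factors unit vectors.
    refine ⟨(‖b‖ : ℂ) • a, b', ?_, hb', ?_⟩
    · rw [norm_smul, Complex.norm_real, norm_norm, mul_comm, hn]
    · rw [h]
      conv_lhs => rw [eb]
      rw [map_smulₛₗ, Complex.conj_ofReal, map_smul, smul_apply]
  rcases hF.common_factor hx₀' hy₀' h₀ with h | h
  -- A common range in the first variable forces a common support in the second, so the previous
  -- theorem applies to the flipped map.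
  · right
    refine hF.flip.exists_factorization (fun c => ?_) hB hA hy₀ hx₀ ha hb h₀ ?_ |>.imp
      fun u => Exists.imp fun v huv x y => huv y x
    · rw [hστ, starRingEnd_self_apply]
    · exact (hF.flip.common_factor hy₀' hx₀' h₀).resolve_left
        fun h' => hF.not_common_range hA hB hx₀' hy₀' h h'
  · exact .inl (hF.exists_factorization hστ hA hB hx₀ hy₀ ha hb h₀ h)

end IsRankOneMap

end RankOneMaps

/-! ### Minimal tripotents and transition pseudo-probabilities -/

section Tripotents

variable {H K : Type*} [NormedAddCommGroup H] [InnerProductSpace ℂ H] [CompleteSpace H]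
  [NormedAddCommGroup K] [InnerProductSpace ℂ K] [CompleteSpace K]

theorem tripleProduct_rankOne_apply (ξ : K) (η : H) (x : H →L[ℂ] K) (z : H) :
    tripleProduct (rankOne ℂ ξ η) (rankOne ℂ ξ η) x z =
      (1 / 2 : ℂ) • ((inner ℂ η η * inner ℂ ξ (x z) : ℂ) • ξ +
        (inner ℂ η z * inner ℂ ξ ξ : ℂ) • x η) := by
  simp only [tripleProduct, smul_apply, add_apply, ContinuousLinearMap.comp_apply,
    adjoint_rankOne, rankOne_apply,    map_smul, smul_smul]
  ring_nf

theorem rankOne_mem_minTripotents {ξ : K} {η : H} (hξ : ‖ξ‖ = 1) (hη : ‖η‖ = 1) :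
    rankOne ℂ ξ η ∈ minTripotents H K := by
  have hξξ := inner_self_eq_one_of_norm hξ
  have hηη := inner_self_eq_one_of_norm hη
  have htrip : tripleProduct (rankOne ℂ ξ η) (rankOne ℂ ξ η) (rankOne ℂ ξ η) =
      rankOne ℂ ξ η := by
    ext z
    rw [tripleProduct_rankOne_apply]
    simp only [rankOne_apply, inner_smul_right, hξξ, hηη]
    module
  refine ⟨htrip, ?_, ?_⟩
  · ext x
    simp only [peirceTwo, Set.mem_ofPred_eq, SetLike.mem_coe, Submodule.mem_span_singleton]
    constructor
    · intro hx
      -- The eigenvalue equation, doubled. At z = η it puts x η in ℂ ξ; paired with ξ it gives ⟨ξ, x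
      -- z⟩ = ⟨η, z⟩⟨ξ, x η⟩. Together they determine x up to a scalar.
      have h : ∀ z, (inner ℂ ξ (x z) : ℂ) • ξ + (inner ℂ η z : ℂ) • x η = (2 : ℂ) • x z := by
        intro z
        have := congrArg (fun T : H →L[ℂ] K => (2 : ℂ) • T z) hx
        simp only [tripleProduct_rankOne_apply, hηη, hξξ, one_mul, mul_one, smul_smul] at this
        norm_num at this
        exact this
      have hxη : x η = (inner ℂ ξ (x η) : ℂ) • ξ := by
        have := h η
        rw [hηη, one_smul, two_smul, add_left_inj] at this
        exact this.symm
      refine ⟨inner ℂ ξ (x η), ?_⟩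
      ext z
      have h1 : inner ℂ ξ (x z) = (inner ℂ η z * inner ℂ ξ (x η) : ℂ) := by
        have := congrArg (fun w => (inner ℂ ξ w : ℂ)) (h z)
        simp only [inner_add_right, inner_smul_right, hξξ] at this
        linear_combination -this
      have h2 := h z
      rw [h1, hxη, inner_smul_right, hξξ, mul_one] at h2
      have h3 : x z = (1 / 2 : ℂ) • (2 : ℂ) • x z := by module
      rw [h3, ← h2, smul_apply, rankOne_apply]
      module
    · rintro ⟨c, rfl⟩
      ext z
      rw [tripleProduct_rankOne_apply]
      simp only [smul_apply, rankOne_apply, inner_smul_right, hξξ, hηη]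
      module
  · rw [Ne, ← norm_eq_zero, norm_rankOne, hξ, hη]
    norm_num

theorem TTP_eq_inner (e v : minTripotents H K) {ξ : K} {η : H} (hξ : ‖ξ‖ = 1) (hη : ‖η‖ = 1)
    (hv : (v : H →L[ℂ] K) = rankOne ℂ ξ η) :
    TTP e v = inner ℂ ξ ((e : H →L[ℂ] K) η) := by
  have h := (Classical.choose_spec (existsUnique_pureAtom v.2).exists).2 e
  have h' := peirceTwoProj_rankOne hξ hη (e : H →L[ℂ] K)
  rw [← hv] at h'
  exact smul_left_injective ℂ v.2.2.2 (h.symm.trans h')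

theorem tripleProduct_rankOne_left_right (ξ : K) (η : H) (x : H →L[ℂ] K) :
    tripleProduct (rankOne ℂ ξ η) x (rankOne ℂ ξ η) = (inner ℂ (x η) ξ : ℂ) • rankOne ℂ ξ η := by
  ext z
  simp only [tripleProduct, smul_apply, add_apply, ContinuousLinearMap.comp_apply, rankOne_apply,
    map_smul, adjoint_inner_right]
  module

end Tripotents

/-! ### Uniqueness, extension to elementary tensors, and the two model isomorphisms -/

section Extension

variable {H₁ K₁ H₂ K₂ : Type*}
  [NormedAddCommGroup H₁] [InnerProductSpace ℂ H₁] [CompleteSpace H₁]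
  [NormedAddCommGroup K₁] [InnerProductSpace ℂ K₁] [CompleteSpace K₁]
  [NormedAddCommGroup H₂] [InnerProductSpace ℂ H₂] [CompleteSpace H₂]
  [NormedAddCommGroup K₂] [InnerProductSpace ℂ K₂] [CompleteSpace K₂]

/-- A triple isomorphism is determined by its values on minimal tripotents. -/
theorem IsTripleIso.eq_of_eqOn_minTripotents {S T : (H₁ →L[ℂ] K₁) ≃ₗ[ℂ] (H₂ →L[ℂ] K₂)}
    (hS : IsTripleIso S) (hT : IsTripleIso T)
    {Φ : minTripotents H₁ K₁ → minTripotents H₂ K₂} (hΦ : Function.Surjective Φ)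
    (hSΦ : ∀ e : minTripotents H₁ K₁, S (e : H₁ →L[ℂ] K₁) = (Φ e : H₂ →L[ℂ] K₂))
    (hTΦ : ∀ e : minTripotents H₁ K₁, T (e : H₁ →L[ℂ] K₁) = (Φ e : H₂ →L[ℂ] K₂)) : S = T := by
  refine LinearEquiv.ext fun x => eq_of_inner_apply_eq fun a b ha hb => ?_
  obtain ⟨e, he⟩ := hΦ ⟨rankOne ℂ a b, rankOne_mem_minTripotents ha hb⟩
  have he' : (Φ e : H₂ →L[ℂ] K₂) = rankOne ℂ a b := by rw [he]
  obtain ⟨ξ, η, -, -, heq⟩ := exists_rankOne_of_mem_minTripotents e.2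
  -- Apply R to {e, x, e} = ⟨x η, ξ⟩ e and compare coefficients of Φ e ≠ 0: the coefficient of R x
  -- at (b, a) depends only on x and Φ.
  have key : ∀ R : (H₁ →L[ℂ] K₁) ≃ₗ[ℂ] (H₂ →L[ℂ] K₂), IsTripleIso R →
      (∀ e : minTripotents H₁ K₁, R (e : H₁ →L[ℂ] K₁) = (Φ e : H₂ →L[ℂ] K₂)) →
      (inner ℂ (x η) ξ : ℂ) = inner ℂ (R x b) a := by
    intro R hR hRΦ
    have h := hR e x e
    rw [hRΦ e, he', tripleProduct_rankOne_left_right, heq, tripleProduct_rankOne_left_right,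
      map_smul, ← heq, hRΦ e] at h
    refine smul_left_injective ℂ (Φ e).2.2.2 ?_
    simpa only [he'] using h
  rw [← inner_conj_symm, ← key S hS hSΦ, key T hT hTΦ, inner_conj_symm]

open Classical in
/-- The positively homogeneous extension of a map of minimal tripotents to elementary tensors. -/
noncomputable def tensorExtension (Φ : minTripotents H₁ K₁ → minTripotents H₂ K₂)
    (ξ : K₁) (η : H₁) : H₂ →L[ℂ] K₂ :=
  -- The test fails exactly when ξ or η is zero, as the normalized tensor is then zero.
  if h : rankOne ℂ ((‖ξ‖ : ℂ)⁻¹ • ξ) ((‖η‖ : ℂ)⁻¹ • η) ∈ minTripotents H₁ K₁ then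
    ((‖ξ‖ : ℂ) * ‖η‖) • (Φ ⟨_, h⟩ : H₂ →L[ℂ] K₂) else 0

variable {Φ : minTripotents H₁ K₁ → minTripotents H₂ K₂}

theorem tensorExtension_smul_smul {ξ : K₁} {η : H₁} (hξ : ‖ξ‖ = 1) (hη : ‖η‖ = 1) {r s : ℝ}
    (hr : 0 < r) (hs : 0 < s) :
    tensorExtension Φ ((r : ℂ) • ξ) ((s : ℂ) • η) =
      ((r : ℂ) * s) • (Φ ⟨rankOne ℂ ξ η, rankOne_mem_minTripotents hξ hη⟩ : H₂ →L[ℂ] K₂) := by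
  have h1 : ‖(r : ℂ) • ξ‖ = r := by
    rw [norm_smul, hξ, mul_one, Complex.norm_real, Real.norm_of_nonneg hr.le]
  have h2 : ‖(s : ℂ) • η‖ = s := by
    rw [norm_smul, hη, mul_one, Complex.norm_real, Real.norm_of_nonneg hs.le]
  have hr' : (r : ℂ) ≠ 0 := by exact_mod_cast hr.ne'
  have hs' : (s : ℂ) ≠ 0 := by exact_mod_cast hs.ne'
  have hξr : (‖(r : ℂ) • ξ‖ : ℂ)⁻¹ • (r : ℂ) • ξ = ξ := by
    rw [h1, smul_smul, inv_mul_cancel₀ hr', one_smul]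
  have hηs : (‖(s : ℂ) • η‖ : ℂ)⁻¹ • (s : ℂ) • η = η := by
    rw [h2, smul_smul, inv_mul_cancel₀ hs', one_smul]
  have hmem := rankOne_mem_minTripotents hξ hη
  rw [← hξr, ← hηs] at hmem
  rw [tensorExtension, dif_pos hmem]
  refine congrArg₂ (· • ·) (by rw [h1, h2]) ?_
  simp only [hξr, hηs]

theorem tensorExtension_of_norm_eq_one {ξ : K₁} {η : H₁} (hξ : ‖ξ‖ = 1) (hη : ‖η‖ = 1) :
    tensorExtension Φ ξ η =
      (Φ ⟨rankOne ℂ ξ η, rankOne_mem_minTripotents hξ hη⟩ : H₂ →L[ℂ] K₂) := by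
  simpa using tensorExtension_smul_smul (Φ := Φ) hξ hη one_pos one_pos

theorem tensorExtension_eq_zero {ξ : K₁} {η : H₁} (h : ξ = 0 ∨ η = 0) :
    tensorExtension Φ ξ η = 0 := by
  unfold tensorExtension
  split_ifs
  · rcases h with rfl | rfl <;> simp
  · rfl

/-- For unit vectors ξ, η this is the invariance of TTP; both sides are positively homogeneous in ξ
and in η. -/
theorem inner_tensorExtension (hTTP : ∀ e v : minTripotents H₁ K₁, TTP (Φ v) (Φ e) = TTP v e)
    {α : K₁} {β : H₁} {a : K₂} {b : H₂} (hα : ‖α‖ = 1) (hβ : ‖β‖ = 1) (ha : ‖a‖ = 1)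
    (hb : ‖b‖ = 1) (h : (Φ ⟨rankOne ℂ α β, rankOne_mem_minTripotents hα hβ⟩ : H₂ →L[ℂ] K₂) =
      rankOne ℂ a b) (ξ : K₁) (η : H₁) :
    (inner ℂ a (tensorExtension Φ ξ η b) : ℂ) = inner ℂ α (rankOne ℂ ξ η β) := by
  by_cases h0 : ξ = 0 ∨ η = 0
  · rw [tensorExtension_eq_zero h0, rankOne_eq_zero.2 h0]
    simp
  push Not at h0
  obtain ⟨ξ', hξ', eξ⟩ := exists_normalize h0.1
  obtain ⟨η', hη', eη⟩ := exists_normalize h0.2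
  have h1 := hTTP ⟨_, rankOne_mem_minTripotents hα hβ⟩ ⟨_, rankOne_mem_minTripotents hξ' hη'⟩
  rw [TTP_eq_inner _ _ ha hb h, TTP_eq_inner _ _ hα hβ rfl] at h1
  rw [eξ, eη, tensorExtension_smul_smul hξ' hη' (norm_pos_iff.2 h0.1) (norm_pos_iff.2 h0.2),
    smul_apply, inner_smul_right, h1]
  simp only [rankOne_apply, inner_smul_right, inner_smul_left, Complex.conj_ofReal]
  ring

theorem isRankOneMap_tensorExtension (hΦ : Function.Surjective Φ)
    (hTTP : ∀ e v : minTripotents H₁ K₁, TTP (Φ v) (Φ e) = TTP v e) :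
    IsRankOneMap (RingHom.id ℂ) (starRingEnd ℂ) (tensorExtension Φ) := by
  have hpre : ∀ (a : K₂) (b : H₂), ‖a‖ = 1 → ‖b‖ = 1 → ∃ (α : K₁) (β : H₁) (hα : ‖α‖ = 1)
      (hβ : ‖β‖ = 1), (Φ ⟨rankOne ℂ α β, rankOne_mem_minTripotents hα hβ⟩ : H₂ →L[ℂ] K₂) =
        rankOne ℂ a b := by
    intro a b ha hb
    obtain ⟨⟨e, he⟩, h⟩ := hΦ ⟨rankOne ℂ a b, rankOne_mem_minTripotents ha hb⟩
    obtain ⟨α, β, hα, hβ, rfl⟩ := exists_rankOne_of_mem_minTripotents he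
    exact ⟨α, β, hα, hβ, by rw [h]⟩
  -- Coefficients against all unit pairs (a, b) are coefficients of the original tensors, so the
  -- relation transfers.
  have hadd : ∀ ξ η ξ₁ η₁ ξ₂ η₂, (rankOne ℂ ξ η : H₁ →L[ℂ] K₁) = rankOne ℂ ξ₁ η₁ + rankOne ℂ ξ₂ η₂ →
      tensorExtension Φ ξ η = tensorExtension Φ ξ₁ η₁ + tensorExtension Φ ξ₂ η₂ := by
    intro ξ η ξ₁ η₁ ξ₂ η₂ h
    refine eq_of_inner_apply_eq fun a b ha hb => ?_
    obtain ⟨α, β, hα, hβ, hab⟩ := hpre a b ha hb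
    rw [add_apply, inner_add_right]
    simp only [inner_tensorExtension hTTP hα hβ ha hb hab]
    rw [h, add_apply, inner_add_right]
  have hsmul : ∀ (c : ℂ) ξ η ξ₁ η₁, (rankOne ℂ ξ η : H₁ →L[ℂ] K₁) = c • rankOne ℂ ξ₁ η₁ →
      tensorExtension Φ ξ η = c • tensorExtension Φ ξ₁ η₁ := by
    intro c ξ η ξ₁ η₁ h
    refine eq_of_inner_apply_eq fun a b ha hb => ?_
    obtain ⟨α, β, hα, hβ, hab⟩ := hpre a b ha hb
    rw [smul_apply, inner_smul_right]
    simp only [inner_tensorExtension hTTP hα hβ ha hb hab]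
    rw [h, smul_apply, inner_smul_right]
  have hrank : ∀ ξ η, ∃ a b, tensorExtension Φ ξ η = rankOne ℂ a b ∧
      ‖(rankOne ℂ a b : H₂ →L[ℂ] K₂)‖ = ‖ξ‖ * ‖η‖ := by
    intro ξ η
    by_cases h0 : ξ = 0 ∨ η = 0
    · refine ⟨0, 0, (tensorExtension_eq_zero h0).trans (rankOne_eq_zero.2 (.inl rfl)).symm, ?_⟩
      rcases h0 with rfl | rfl <;> simp
    push Not at h0
    obtain ⟨ξ', hξ', eξ⟩ := exists_normalize h0.1
    obtain ⟨η', hη', eη⟩ := exists_normalize h0.2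
    obtain ⟨a, b, ha, hb, hab⟩ := exists_rankOne_of_mem_minTripotents
      (Φ ⟨_, rankOne_mem_minTripotents hξ' hη'⟩).2
    refine ⟨((‖ξ‖ : ℂ) * ‖η‖) • a, b, ?_, ?_⟩
    · conv_lhs => rw [eξ, eη, tensorExtension_smul_smul hξ' hη' (norm_pos_iff.2 h0.1)
        (norm_pos_iff.2 h0.2), hab]
      rw [map_smul, smul_apply]
    · rw [norm_rankOne, norm_smul, ha, hb]
      simp
  refine ⟨fun x x' y => hadd _ _ _ _ _ _ (by rw [map_add, add_apply]),
    fun x y y' => hadd _ _ _ _ _ _ (by rw [map_add]),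
    fun c x y => hsmul _ _ _ _ _ (by rw [map_smul, smul_apply]; rfl),
    fun c x y => hsmul _ _ _ _ _ (by rw [map_smulₛₗ]), fun x y => ?_, fun x y => ?_,
    fun a b => ?_, fun x₁ y₁ x₂ y₂ x y hx hy h => ?_⟩
  · obtain ⟨a, b, h, h'⟩ := hrank x y
    rw [h, h']
  · obtain ⟨a, b, h, -⟩ := hrank x y
    exact ⟨a, b, h⟩
  · by_cases h0 : a = 0 ∨ b = 0
    · exact ⟨0, 0, by rw [tensorExtension_eq_zero (.inl rfl), rankOne_eq_zero.2 h0]⟩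
    push Not at h0
    obtain ⟨a', ha', ea⟩ := exists_normalize h0.1
    obtain ⟨b', hb', eb⟩ := exists_normalize h0.2
    obtain ⟨α, β, hα, hβ, hab⟩ := hpre a' b' ha' hb'
    refine ⟨(‖a‖ : ℂ) • α, (‖b‖ : ℂ) • β, ?_⟩
    rw [tensorExtension_smul_smul hα hβ (norm_pos_iff.2 h0.1) (norm_pos_iff.2 h0.2), hab]
    conv_rhs => rw [ea, eb]
    rw [map_smulₛₗ, Complex.conj_ofReal, map_smul, smul_apply, smul_smul, mul_comm]
  -- The transfer in the opposite direction: each unit pair (α, β) has an image pair (a, b), so the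
  -- relation between values of F holds between the tensors themselves.
  · refine parallel_of_rankOne_add_rankOne hx hy (e := x) (f := y) ?_
    refine eq_of_inner_apply_eq fun α β hα hβ => ?_
    obtain ⟨a, b, ha, hb, hab⟩ := exists_rankOne_of_mem_minTripotents
      (Φ ⟨_, rankOne_mem_minTripotents hα hβ⟩).2
    rw [add_apply, inner_add_right]
    simp only [← inner_tensorExtension hTTP hα hβ ha hb hab]
    rw [← h, add_apply, inner_add_right]

/-- The triple isomorphism `x ↦ u x v⁻¹` induced by linear isometries. -/
theorem exists_isTripleIso_of_isometry (u : K₁ ≃ₗᵢ[ℂ] K₂) (v : H₁ ≃ₗᵢ[ℂ] H₂) :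
    ∃ T : (H₁ →L[ℂ] K₁) ≃ₗ[ℂ] (H₂ →L[ℂ] K₂), IsTripleIso T ∧
      ∀ x ζ, T x ζ = u (x (v.symm ζ)) := by
  let T : (H₁ →L[ℂ] K₁) ≃ₗ[ℂ] (H₂ →L[ℂ] K₂) :=
    { toFun := fun x => (u : K₁ →L[ℂ] K₂) ∘L (x ∘L (v.symm : H₂ →L[ℂ] H₁))
      invFun := fun y => (u.symm : K₂ →L[ℂ] K₁) ∘L (y ∘L (v : H₁ →L[ℂ] H₂))
      map_add' := fun x y => by ext; simp
      map_smul' := fun c x => by ext; simp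
      left_inv := fun x => by ext; simp
      right_inv := fun y => by ext; simp }
  have hT : ∀ x ζ, T x ζ = u (x (v.symm ζ)) := fun _ _ => rfl
  have hadj : ∀ x κ, adjoint (T x) (u κ) = v (adjoint x κ) := by
    intro x κ
    refine ext_inner_right ℂ fun ζ => ?_
    rw [adjoint_inner_left, hT, u.inner_map_map, ← v.apply_symm_apply ζ, v.inner_map_map,
      adjoint_inner_left, v.symm_apply_apply]
  refine ⟨T, fun x y z => ?_, hT⟩
  ext ζ
  simp only [tripleProduct, hT, hadj, smul_apply, add_apply, ContinuousLinearMap.comp_apply,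
    map_smul, map_add, LinearIsometryEquiv.symm_apply_apply]

/-- By polarization. Conjugate-linearity exchanges ‖x + i y‖ and ‖x - i y‖, and so does swapping x
and y, since y + i x = i (x - i y). -/
theorem inner_map_map_of_conj {E F : Type*} [NormedAddCommGroup E] [InnerProductSpace ℂ E]
    [NormedAddCommGroup F] [InnerProductSpace ℂ F] (u : E ≃ₗᵢ⋆[ℂ] F) (x y : E) :
    (inner ℂ (u x) (u y) : ℂ) = inner ℂ y x := by
  have hI : ∀ z : E, u (Complex.I • z) = -(Complex.I • u z) := fun z => by
    rw [map_smulₛₗ, Complex.conj_I, neg_smul]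
  have h1 : ‖u x - Complex.I • u y‖ = ‖x + Complex.I • y‖ := by
    rw [← u.norm_map (x + _), map_add, hI, sub_eq_add_neg]
  have h2 : ‖u x + Complex.I • u y‖ = ‖x - Complex.I • y‖ := by
    rw [← u.norm_map (x - _), map_sub, hI, sub_neg_eq_add]
  have h3 : ‖y + Complex.I • x‖ = ‖x - Complex.I • y‖ := by
    have : y + Complex.I • x = Complex.I • (x - Complex.I • y) := by
      rw [smul_sub, smul_smul, Complex.I_mul_I]; module
    rw [this, norm_smul, Complex.norm_I, one_mul]
  have h4 : ‖y - Complex.I • x‖ = ‖x + Complex.I • y‖ := by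
    have : y - Complex.I • x = -Complex.I • (x + Complex.I • y) := by
      rw [smul_add, smul_smul, neg_mul, Complex.I_mul_I]; module
    rw [this, norm_smul, norm_neg, Complex.norm_I, one_mul]
  rw [inner_eq_sum_norm_sq_div_four, inner_eq_sum_norm_sq_div_four]
  have h5 : (RCLike.I : ℂ) = Complex.I := rfl
  rw [h5, h1, h2, h3, h4, ← map_add, ← map_sub, u.norm_map, u.norm_map, add_comm y x,
    norm_sub_rev y x]

/-- The triple isomorphism `x ↦ u x* v⁻¹` induced by conjugate-linear isometries. -/
theorem exists_isTripleIso_of_conj_isometry (u : H₁ ≃ₗᵢ⋆[ℂ] K₂) (v : K₁ ≃ₗᵢ⋆[ℂ] H₂) :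
    ∃ T : (H₁ →L[ℂ] K₁) ≃ₗ[ℂ] (H₂ →L[ℂ] K₂), IsTripleIso T ∧
      ∀ x ζ, T x ζ = u (adjoint x (v.symm ζ)) := by
  have hu := inner_map_map_of_conj u
  have hv := inner_map_map_of_conj v
  let T : (H₁ →L[ℂ] K₁) ≃ₗ[ℂ] (H₂ →L[ℂ] K₂) :=
    { toFun := fun x => (u : H₁ →L⋆[ℂ] K₂).comp
        ((adjoint x).comp (v.symm : H₂ →L⋆[ℂ] K₁))
      invFun := fun y => adjoint ((u.symm : K₂ →L⋆[ℂ] H₁).comp (y.comp (v : K₁ →L⋆[ℂ] H₂)))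
      map_add' := fun x y => by ext; simp
      map_smul' := fun c x => by
        ext ζ
        change u (adjoint (c • x) (v.symm ζ)) = c • u (adjoint x (v.symm ζ))
        rw [map_smulₛₗ, smul_apply, map_smulₛₗ, starRingEnd_self_apply]
      left_inv := fun x => by
        have h : (u.symm : K₂ →L⋆[ℂ] H₁).comp (((u : H₁ →L⋆[ℂ] K₂).comp
            ((adjoint x).comp (v.symm : H₂ →L⋆[ℂ] K₁))).comp (v : K₁ →L⋆[ℂ] H₂)) = adjoint x := by
          ext κ
          change u.symm (u (adjoint x (v.symm (v κ)))) = adjoint x κ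
          rw [u.symm_apply_apply, v.symm_apply_apply]
        exact (congrArg adjoint h).trans (adjoint_adjoint x)
      right_inv := fun y => by
        ext ζ
        change u (adjoint (adjoint ((u.symm : K₂ →L⋆[ℂ] H₁).comp
          (y.comp (v : K₁ →L⋆[ℂ] H₂)))) (v.symm ζ)) = y ζ
        rw [adjoint_adjoint]
        change u (u.symm (y (v (v.symm ζ)))) = y ζ
        rw [u.apply_symm_apply, v.apply_symm_apply] }
  have hT : ∀ x ζ, T x ζ = u (adjoint x (v.symm ζ)) := fun _ _ => rfl
  -- That is, (T x)* = v x u⁻¹, so the inner isometries cancel in a triple product of images.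
  have hadj : ∀ x η, adjoint (T x) (u η) = v (x η) := by
    intro x η
    refine ext_inner_right ℂ fun ζ => ?_
    rw [adjoint_inner_left, hT, hu, ← v.apply_symm_apply ζ, hv, v.symm_apply_apply,
      adjoint_inner_left]
  refine ⟨T, fun x y z => ?_, hT⟩
  ext ζ
  have hhalf : starRingEnd ℂ (1 / 2 : ℂ) = 1 / 2 := by
    rw [map_div₀, map_one, Complex.conj_ofNat]
  -- The adjoint reverses each product, which only exchanges the two summands of the triple product.
  have hadj3 : adjoint (tripleProduct x y z) = tripleProduct (adjoint x) (adjoint y) (adjoint z) := by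
    simp only [tripleProduct, map_smulₛₗ, map_add, adjoint_comp, adjoint_adjoint,
      ContinuousLinearMap.comp_assoc]
    rw [add_comm, hhalf]
  rw [hT, hadj3]
  simp only [tripleProduct, hT, hadj, smul_apply, add_apply, ContinuousLinearMap.comp_apply,
    map_smulₛₗ, map_add, LinearIsometryEquiv.symm_apply_apply, adjoint_adjoint, hhalf]

end Extension

end TypeOneCartan

/-! ### The main theorem -/

open TypeOneCartan
theorem theorem4p4 {H₁ K₁ H₂ K₂ : Type*}
    [NormedAddCommGroup H₁] [InnerProductSpace ℂ H₁] [CompleteSpace H₁]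
    [NormedAddCommGroup K₁] [InnerProductSpace ℂ K₁] [CompleteSpace K₁]
    [NormedAddCommGroup H₂] [InnerProductSpace ℂ H₂] [CompleteSpace H₂]
    [NormedAddCommGroup K₂] [InnerProductSpace ℂ K₂] [CompleteSpace K₂]
    (hH₁ : 2 ≤ Module.rank ℂ H₁) (hK₁ : 2 ≤ Module.rank ℂ K₁)
    (hH₂ : 2 ≤ Module.rank ℂ H₂) (hK₂ : 2 ≤ Module.rank ℂ K₂)
    (Φ : minTripotents H₁ K₁ → minTripotents H₂ K₂) (hΦ : Function.Bijective Φ)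
    (hTTP : ∀ e v : minTripotents H₁ K₁, TTP (Φ v) (Φ e) = TTP v e) :
    ∃ T : (H₁ →L[ℂ] K₁) ≃ₗ[ℂ] (H₂ →L[ℂ] K₂),
      IsTripleIso T ∧
      (∀ e : minTripotents H₁ K₁, T (e : H₁ →L[ℂ] K₁) = (Φ e : H₂ →L[ℂ] K₂)) ∧
      (∀ S : (H₁ →L[ℂ] K₁) ≃ₗ[ℂ] (H₂ →L[ℂ] K₂), IsTripleIso S →
        (∀ e : minTripotents H₁ K₁, S (e : H₁ →L[ℂ] K₁) = (Φ e : H₂ →L[ℂ] K₂)) → S = T) ∧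
      ((∃ (u : K₁ ≃ₗᵢ[ℂ] K₂) (v : H₁ ≃ₗᵢ[ℂ] H₂),
          ∀ (x : H₁ →L[ℂ] K₁) (ζ : H₂), T x ζ = u (x (v.symm ζ))) ∨
        (∃ (u : H₁ ≃ₗᵢ⋆[ℂ] K₂) (v : K₁ ≃ₗᵢ⋆[ℂ] H₂),
          ∀ (x : H₁ →L[ℂ] K₁) (ζ : H₂),
            T x ζ = u (ContinuousLinearMap.adjoint x (v.symm ζ)))) := by
  have hF := isRankOneMap_tensorExtension hΦ.2 hTTP
  have hrest : ∀ T : (H₁ →L[ℂ] K₁) ≃ₗ[ℂ] (H₂ →L[ℂ] K₂),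
      (∀ ξ η, T (InnerProductSpace.rankOne ℂ ξ η) = tensorExtension Φ ξ η) →
      ∀ e : minTripotents H₁ K₁, T (e : H₁ →L[ℂ] K₁) = (Φ e : H₂ →L[ℂ] K₂) := by
    rintro T hT ⟨e, he⟩
    obtain ⟨ξ, η, hξ, hη, rfl⟩ := exists_rankOne_of_mem_minTripotents he
    rw [hT, tensorExtension_of_norm_eq_one hξ hη]
  -- With σ the identity and τ the conjugation, the direct factorization gives linear isometries and
  -- case (a), the swapped one conjugate-linear isometries and case (b).
  rcases hF.exists_factorization_or_swap (fun c => rfl) hK₁ hH₁ with ⟨u, v, huv⟩ | ⟨u, v, huv⟩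
  · obtain ⟨T, hT, hTuv⟩ := exists_isTripleIso_of_isometry u v
    have hTΦ := hrest T fun ξ η => by
      ext ζ
      rw [hTuv, huv, InnerProductSpace.rankOne_apply, InnerProductSpace.rankOne_apply, map_smul,
        ← v.inner_map_map, v.apply_symm_apply]
    exact ⟨T, hT, hTΦ, fun S hS hSΦ => hS.eq_of_eqOn_minTripotents hT hΦ.2 hSΦ hTΦ,
      .inl ⟨u, v, hTuv⟩⟩
  · obtain ⟨T, hT, hTuv⟩ := exists_isTripleIso_of_conj_isometry u v
    have hTΦ := hrest T fun ξ η => by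
      ext ζ
      rw [hTuv, huv, InnerProductSpace.adjoint_rankOne, InnerProductSpace.rankOne_apply,
        InnerProductSpace.rankOne_apply, map_smulₛₗ, inner_conj_symm, ← inner_map_map_of_conj v,
        v.apply_symm_apply]
    exact ⟨T, hT, hTΦ, fun S hS hSΦ => hS.eq_of_eqOn_minTripotents hT hΦ.2 hSΦ hTΦ,
      .inr ⟨u, v, hTuv⟩⟩
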